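/- Theorem 1.1. Let $m_2, m_3 \ge 1$ be integers, and let $(X_1,X_2,X_3)$ be a centered real-valued Gaussian random vector with $\operatorname{Var}(X_i)>0$ for $i=1,2,3$ (the covariance matrix itself may be singular). Then $$E[X_1^{2} X_2^{2m_2} X_3^{2m_3}]\;\ge\; E[X_1^{2}]\,E[X_2^{2m_2}]\,E[X_3^{2m_3}].$$ Equality holds if and only if $X_1,X_2,X_3$ are (mutually) independent. -/

import Mathlib

open MeasureTheory ProbabilityTheory

/-- The mixed moment `E[Y ^ j * Z ^ k]` of a centered Gaussian pair with unit variances and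
covariance `c`, as a function of `c`. -/
noncomputable def gaussianMixedMoment (c : ℝ) : ℕ → ℕ → ℝ
  | 0, 0 => 1
  | 0, 1 => 0
  | 0, k + 2 => (k + 1) * gaussianMixedMoment c 0 k
  | 1, k => c * k * gaussianMixedMoment c 0 (k - 1)
  | j + 2, k =>
    (j + 1) * gaussianMixedMoment c j k + c * k * gaussianMixedMoment c (j + 1) (k - 1)
termination_by j k => (j, k)

namespace gaussianMixedMoment

variable {c : ℝ}

theorem zero_zero : gaussianMixedMoment c 0 0 = 1 := by rw [gaussianMixedMoment]

theorem succ_left (j k : ℕ) :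
    gaussianMixedMoment c (j + 1) k =
      j * gaussianMixedMoment c (j - 1) k + c * k * gaussianMixedMoment c j (k - 1) := by
  cases j with
  | zero => rw [gaussianMixedMoment]; simp
  | succ j => rw [gaussianMixedMoment]; simp

theorem succ_right (j k : ℕ) :
    gaussianMixedMoment c j (k + 1) =
      k * gaussianMixedMoment c j (k - 1) + c * j * gaussianMixedMoment c (j - 1) k := by
  induction j using Nat.strong_induction_on generalizing k with
  | _ j ih =>
    cases j with
    | zero =>
      cases k with
      | zero => simp [gaussianMixedMoment]
      | succ k => rw [gaussianMixedMoment]; simp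
    | succ j =>
      have e1 : gaussianMixedMoment c (j + 1) (k + 1) =
          j * gaussianMixedMoment c (j - 1) (k + 1) +
            c * (k + 1) * gaussianMixedMoment c j k := by
        rw [succ_left]; push_cast; simp
      have e2 : (j : ℝ) * gaussianMixedMoment c (j - 1) (k + 1) =
          j * (k * gaussianMixedMoment c (j - 1) (k - 1) +
            c * (j - 1 : ℝ) * gaussianMixedMoment c (j - 1 - 1) k) := by
        cases j with
        | zero => simp
        | succ j => rw [ih (j + 1 - 1) (by omega)]; push_cast; simp
      have e3 := succ_left (c := c) j (k - 1)
      have e4 : (j : ℝ) * gaussianMixedMoment c j k =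
          j * ((j - 1 : ℝ) * gaussianMixedMoment c (j - 1 - 1) k +
            c * k * gaussianMixedMoment c (j - 1) (k - 1)) := by
        cases j with
        | zero => simp
        | succ j => rw [succ_left]; push_cast; simp
      have e5 : (k : ℝ) * gaussianMixedMoment c j k =
          k * ((k - 1 : ℝ) * gaussianMixedMoment c j (k - 1 - 1) +
            c * j * gaussianMixedMoment c (j - 1) (k - 1)) := by
        cases k with
        | zero => simp
        | succ k => rw [ih j (by omega)]; push_cast; simp
      have e6 : (k : ℝ) * ((k - 1 : ℕ) : ℝ) = k * (k - 1 : ℝ) := by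
        cases k <;> simp
      rw [e1, e2, e3, Nat.add_sub_cancel]
      push_cast
      linear_combination c * (e5 - e4 - gaussianMixedMoment c j (k - 1 - 1) * e6)

theorem zero_left (c d : ℝ) (k : ℕ) :
    gaussianMixedMoment c 0 k = gaussianMixedMoment d 0 k := by
  induction k using Nat.strong_induction_on with
  | _ k ih =>
    cases k with
    | zero => simp [zero_zero]
    | succ k => rw [succ_right, succ_right, ih (k - 1) (by omega)]; simp

theorem eq_mul_of_zero (c : ℝ) (j k : ℕ) :
    gaussianMixedMoment 0 j k = gaussianMixedMoment c j 0 * gaussianMixedMoment c 0 k := by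
  induction j using Nat.strong_induction_on with
  | _ j ih =>
    cases j with
    | zero => rw [zero_zero, one_mul, zero_left]
    | succ j => rw [succ_left, succ_left, ih (j - 1) (by omega)]; simp [mul_assoc]

theorem hasDerivAt (j k : ℕ) (c : ℝ) :
    HasDerivAt (fun c => gaussianMixedMoment c j k)
      (j * k * gaussianMixedMoment c (j - 1) (k - 1)) c := by
  induction j using Nat.strong_induction_on generalizing k with
  | _ j ih =>
    cases j with
    | zero =>
      have e : (fun c => gaussianMixedMoment c 0 k) = fun _ => gaussianMixedMoment 0 0 k :=
        funext fun c => zero_left c 0 k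
      rw [e]
      simpa using hasDerivAt_const c (gaussianMixedMoment 0 0 k)
    | succ j =>
      have e : (fun c => gaussianMixedMoment c (j + 1) k) = fun c =>
          j * gaussianMixedMoment c (j - 1) k + c * k * gaussianMixedMoment c j (k - 1) :=
        funext fun c => succ_left j k
      rw [e]
      have h1 : HasDerivAt (fun c => (j : ℝ) * gaussianMixedMoment c (j - 1) k)
          (j * ((j - 1 : ℝ) * k * gaussianMixedMoment c (j - 1 - 1) (k - 1))) c := by
        cases j with
        | zero => simpa using hasDerivAt_const c (0 : ℝ)
        | succ j =>
          have := (ih (j + 1 - 1) (by omega) k).const_mul ((j + 1 : ℕ) : ℝ)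
          push_cast at this ⊢
          simpa using this
      have h2 := ((hasDerivAt_id c).mul_const (k : ℝ)).mul (ih j (by omega) (k - 1))
      refine (h1.add h2).congr_deriv ?_
      have e4 : (j : ℝ) * gaussianMixedMoment c j (k - 1) =
          j * ((j - 1 : ℝ) * gaussianMixedMoment c (j - 1 - 1) (k - 1) +
            c * (k - 1 : ℕ) * gaussianMixedMoment c (j - 1) (k - 1 - 1)) := by
        cases j with
        | zero => simp
        | succ j => rw [succ_left]; push_cast; simp
      simp only [id, Nat.add_sub_cancel]
      push_cast
      linear_combination - (k : ℝ) * e4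

theorem neg_param (j k : ℕ) :
    gaussianMixedMoment (-c) j k = (-1) ^ j * gaussianMixedMoment c j k := by
  induction j using Nat.strong_induction_on generalizing k with
  | _ j ih =>
    cases j with
    | zero =>
      induction k using Nat.strong_induction_on with
      | _ k ihk =>
        cases k with
        | zero => simp [zero_zero]
        | succ k =>
          rw [succ_right, succ_right, ihk (k - 1) (by omega)]
          simp
    | succ j =>
      rw [succ_left, succ_left, ih (j - 1) (by omega), ih j (by omega)]
      cases j with
      | zero => simp
      | succ j => simp only [Nat.add_sub_cancel]; ring

theorem zero_odd_left (m k : ℕ) : gaussianMixedMoment 0 (2 * m + 1) k = 0 := by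
  have := neg_param (c := 0) (2 * m + 1) k
  rw [neg_zero, pow_succ, pow_mul] at this
  norm_num at this
  linarith

theorem nonneg (hc : 0 ≤ c) (j k : ℕ) : 0 ≤ gaussianMixedMoment c j k := by
  induction j using Nat.strong_induction_on generalizing k with
  | _ j ih =>
    cases j with
    | zero =>
      induction k using Nat.strong_induction_on with
      | _ k ihk =>
        cases k with
        | zero => simp [zero_zero]
        | succ k =>
          rw [succ_right]
          have := ihk (k - 1) (by omega)
          simp
          positivity
    | succ j =>
      rw [succ_left]
      have h1 := ih (j - 1) (by omega) k
      have h2 := ih j (by omega) (k - 1)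
      positivity

theorem even_even_pos (hc : 0 ≤ c) (m n : ℕ) : 0 < gaussianMixedMoment c (2 * m) (2 * n) := by
  induction m with
  | zero =>
    induction n with
    | zero => simp [zero_zero]
    | succ n ih =>
      rw [show 2 * (n + 1) = 2 * n + 1 + 1 by ring, succ_right]
      simp at ih ⊢
      positivity
  | succ m ih =>
    rw [show 2 * (m + 1) = 2 * m + 1 + 1 by ring, succ_left]
    have := nonneg hc (2 * m + 1) (2 * n - 1)
    simp only [Nat.add_sub_cancel]
    positivity

theorem monotoneOn (j k : ℕ) :
    MonotoneOn (fun c => gaussianMixedMoment c j k) (Set.Ici 0) := by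
  refine monotoneOn_of_hasDerivWithinAt_nonneg (convex_Ici 0)
    (f' := fun c => j * k * gaussianMixedMoment c (j - 1) (k - 1))
    (fun c _ => (hasDerivAt j k c).continuousAt.continuousWithinAt)
    (fun c _ => (hasDerivAt j k c).hasDerivWithinAt) ?_
  intro c hc
  have := nonneg (interior_subset hc : c ∈ Set.Ici 0) (j - 1) (k - 1)
  positivity

theorem zero_le_even_even (m n : ℕ) (c : ℝ) :
    gaussianMixedMoment 0 (2 * m) (2 * n) ≤ gaussianMixedMoment c (2 * m) (2 * n) := by
  wlog hc : 0 ≤ c generalizing c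
  · have := this (-c) (by linarith)
    rwa [neg_param, pow_mul, neg_one_sq, one_pow, one_mul] at this
  exact monotoneOn _ _ Set.self_mem_Ici hc hc

theorem zero_lt_add_two {m : ℕ} (hm : 1 ≤ m) (n : ℕ) (c : ℝ) :
    gaussianMixedMoment 0 (2 * m) (2 * n) < gaussianMixedMoment c (2 * m + 2) (2 * n) := by
  have h1 := zero_le_even_even (m + 1) n c
  have h2 := succ_left (c := 0) (2 * m + 1) (2 * n)
  have h3 := even_even_pos le_rfl m n
  have h4 : (1 : ℝ) ≤ m := by exact_mod_cast hm
  simp only [Nat.add_sub_cancel, zero_mul, add_zero] at h2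
  push_cast at h2
  rw [show 2 * (m + 1) = 2 * m + 1 + 1 by ring, h2] at h1
  refine lt_of_lt_of_le ?_ h1
  nlinarith

theorem odd_odd_pos (hc : 0 < c) (m n : ℕ) :
    0 < gaussianMixedMoment c (2 * m + 1) (2 * n + 1) := by
  rw [succ_left]
  have h1 := nonneg hc.le (2 * m - 1) (2 * n + 1)
  have h2 := even_even_pos hc.le m n
  simp only [Nat.add_sub_cancel]
  positivity

theorem zero_lt_even_even {m n : ℕ} (hm : 1 ≤ m) (hn : 1 ≤ n) (hc : c ≠ 0) :
    gaussianMixedMoment 0 (2 * m) (2 * n) < gaussianMixedMoment c (2 * m) (2 * n) := by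
  wlog hc' : 0 < c generalizing c
  · have := this (c := -c) (by simpa) (by
      rcases lt_or_gt_of_ne hc with h | h
      · linarith
      · exact absurd h hc')
    rwa [neg_param, pow_mul, neg_one_sq, one_pow, one_mul] at this
  have key : StrictMonoOn (fun c => gaussianMixedMoment c (2 * m) (2 * n)) (Set.Ici 0) := by
    refine strictMonoOn_of_hasDerivWithinAt_pos (convex_Ici 0)
      (f' := fun c => ((2 * m : ℕ) : ℝ) * ((2 * n : ℕ) : ℝ) *
        gaussianMixedMoment c (2 * m - 1) (2 * n - 1))
      (fun c _ => (hasDerivAt _ _ c).continuousAt.continuousWithinAt)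
      (fun c _ => (hasDerivAt _ _ c).hasDerivWithinAt) ?_
    intro c hc
    rw [interior_Ici] at hc
    obtain ⟨m, rfl⟩ := Nat.exists_eq_add_of_le' hm
    obtain ⟨n, rfl⟩ := Nat.exists_eq_add_of_le' hn
    have := odd_odd_pos hc m n
    rw [show 2 * (m + 1) - 1 = 2 * m + 1 by omega, show 2 * (n + 1) - 1 = 2 * n + 1 by omega]
    positivity
  exact key Set.self_mem_Ici hc'.le hc'

/-- The second-order differential equation in `c` satisfied by the mixed moments, written in terms
of the moments that are proportional to the first two derivatives. -/
theorem ode (a b : ℕ) :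
    gaussianMixedMoment c (a + 1) (b + 1) =
      (1 - c ^ 2) * (a * b * gaussianMixedMoment c (a - 1) (b - 1)) +
        c * (a + b + 1) * gaussianMixedMoment c a b := by
  have e1 := succ_left (c := c) a (b + 1)
  have e2 := succ_right (c := c) (a - 1) b
  have e3 : (a : ℝ) * gaussianMixedMoment c a b =
      a * (((a - 1 : ℕ) : ℝ) * gaussianMixedMoment c (a - 1 - 1) b +
        c * b * gaussianMixedMoment c (a - 1) (b - 1)) := by
    cases a with
    | zero => simp
    | succ a => rw [succ_left]; push_cast; simp
  rw [Nat.add_sub_cancel] at e1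
  push_cast at e1
  linear_combination e1 + (a : ℝ) * e2 - c * e3

/-- With `f = E[Y ^ (2 * m) * Z ^ (2 * n)]` regarded as a function of the covariance `c` and `g` its
derivative, this is, up to the factor `1 - c ^ 2`, the determinant of
`E[(Y, Z) ⊗ (Y, Z) * Y ^ (2 * m) * Z ^ (2 * n)] - K • Cov(Y, Z)`. -/
noncomputable def reducedDet (N q c K f g : ℝ) : ℝ :=
  (1 - c ^ 2) * (q * f ^ 2 - 2 * N * c * f * g - (1 - c ^ 2) * g ^ 2) +
    ((2 * N + 1) * f - K) * (f - K)

theorem reducedDet_pos {N q K : ℝ} (hN : 0 < N) (hq : 0 < q) (hK : 0 < K) {f g h : ℝ → ℝ}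
    (hf : ∀ c, HasDerivAt f (g c) c) (hg : ∀ c, HasDerivAt g (h c) c)
    (hode : ∀ c, q * f c = (1 - c ^ 2) * h c + c * (2 * N - 1) * g c)
    (hf0 : f 0 = K) (hg0 : g 0 = 0) (hfK : ∀ c, 0 ≤ c → K ≤ f c) (hgn : ∀ c, 0 ≤ c → 0 ≤ g c)
    {c : ℝ} (hc0 : 0 ≤ c) (hc1 : c < 1) : 0 < reducedDet N q c K (f c) (g c) := by
  set W : ℝ → ℝ := fun c => reducedDet N q c K (f c) (g c) with hW
  have hWd : ∀ c, ∃ W', HasDerivAt W W' c ∧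
      (1 - c ^ 2) * W' + 2 * (N + 1) * c * W c =
        2 * (N + 1) * ((1 - c ^ 2) * g c * (f c - K) + c * ((2 * N + 1) * f c - K) * (f c - K)) := by
    intro c
    have h1 : HasDerivAt (fun c : ℝ => 1 - c ^ 2) (-(2 * c)) c := by
      simpa using ((hasDerivAt_pow 2 c).const_sub 1)
    have h2 := h1.mul (((((hf c).pow 2).const_mul q).sub
      ((((hasDerivAt_id c).const_mul (2 * N)).mul (hf c)).mul (hg c))).sub (h1.mul ((hg c).pow 2)))
    have h3 := (((hf c).const_mul (2 * N + 1)).sub_const K).mul ((hf c).sub_const K)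
    refine ⟨_, h2.add h3, ?_⟩
    simp only [hW, reducedDet, id, Pi.pow_apply, Pi.mul_apply, Pi.sub_apply]
    push_cast
    linear_combination
      (1 - c ^ 2) * (2 * N * c * f c + 2 * (1 - c ^ 2) * g c) * hode c
  choose W' hW' hWid using hWd
  have hy : ∀ x ∈ Set.Icc 0 c, 0 < 1 - x ^ 2 := fun x hx => by nlinarith [hx.1, hx.2]
  have hwd : ∀ x ∈ Set.Icc 0 c, HasDerivAt (fun x => (1 - x ^ 2) ^ (-(N + 1)) * W x)
      ((1 - x ^ 2) ^ (-(N + 1) - 1) * ((1 - x ^ 2) * W' x + 2 * (N + 1) * x * W x)) x := by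
    intro x hx
    have h1 : HasDerivAt (fun c : ℝ => 1 - c ^ 2) (-(2 * x)) x := by
      simpa using ((hasDerivAt_pow 2 x).const_sub 1)
    refine ((h1.rpow_const (p := -(N + 1)) (Or.inl (hy x hx).ne')).mul (hW' x)).congr_deriv ?_
    have := Real.rpow_sub_one (hy x hx).ne' (-(N + 1))
    rw [this]
    field_simp [(hy x hx).ne']
    ring
  have hmono : MonotoneOn (fun x => (1 - x ^ 2) ^ (-(N + 1)) * W x) (Set.Icc 0 c) := by
    refine monotoneOn_of_hasDerivWithinAt_nonneg (convex_Icc 0 c)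
      (fun x hx => (hwd x hx).continuousAt.continuousWithinAt)
      (fun x hx => (hwd x (interior_subset hx)).hasDerivWithinAt) ?_
    intro x hx
    replace hx := interior_subset hx
    rw [hWid]
    have h1 := hy x hx
    have h2 := hx.1
    have h3 := sub_nonneg.2 (hfK x hx.1)
    have h4 := hgn x hx.1
    have h5 : 0 ≤ (2 * N + 1) * f x - K := by nlinarith
    positivity
  have h0 : 0 < W 0 := by
    simp only [hW, reducedDet, hf0, hg0]
    simp
    positivity
  have h1 := hmono (Set.left_mem_Icc.2 hc0) (Set.right_mem_Icc.2 hc0) hc0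
  dsimp only at h1
  rw [zero_pow two_ne_zero, sub_zero, Real.one_rpow, one_mul] at h1
  exact pos_of_mul_pos_right (h0.trans_le h1)
    (Real.rpow_nonneg (hy c (Set.right_mem_Icc.2 hc0)).le _)

/-- The strict Gaussian product inequality for the conditional second-moment matrix of a
nondegenerate pair, in determinantal form. -/
theorem det_pos {m n : ℕ} (hm : 1 ≤ m) (hn : 1 ≤ n) (hc : |c| < 1) :
    (gaussianMixedMoment c (2 * m + 1) (2 * n + 1) -
        c * gaussianMixedMoment 0 (2 * m) (2 * n)) ^ 2 <
      (gaussianMixedMoment c (2 * m + 2) (2 * n) - gaussianMixedMoment 0 (2 * m) (2 * n)) *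
        (gaussianMixedMoment c (2 * m) (2 * n + 2) - gaussianMixedMoment 0 (2 * m) (2 * n)) := by
  wlog hc0 : 0 ≤ c generalizing c
  · have h := this (c := -c) (by rwa [abs_neg]) (by linarith)
    simp only [neg_param, pow_add, pow_mul] at h
    norm_num at h
    linarith
  obtain ⟨a, rfl⟩ := Nat.exists_eq_add_of_le' hm
  obtain ⟨b, rfl⟩ := Nat.exists_eq_add_of_le' hn
  rw [abs_of_nonneg hc0] at hc
  have key := reducedDet_pos (N := (a + 1 : ℝ) + (b + 1)) (q := (2 * (a + 1)) * (2 * (b + 1)))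
    (f := fun c => gaussianMixedMoment c (2 * a + 1 + 1) (2 * b + 1 + 1))
    (g := fun c => (2 * (a + 1)) * (2 * (b + 1)) * gaussianMixedMoment c (2 * a + 1) (2 * b + 1))
    (h := fun c => (2 * (a + 1)) * (2 * (b + 1)) *
      (((2 * a + 1 : ℕ) : ℝ) * (2 * b + 1 : ℕ) * gaussianMixedMoment c (2 * a) (2 * b)))
    (by positivity) (by positivity) (even_even_pos le_rfl (a + 1) (b + 1))
    (fun c => (hasDerivAt _ _ c).congr_deriv (by simp only [Nat.add_sub_cancel]; push_cast; ring))
    (fun c => (hasDerivAt _ _ c).const_mul _)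
    (fun c => by
      have := ode (c := c) (2 * a + 1) (2 * b + 1)
      simp only [Nat.add_sub_cancel] at this
      push_cast at this ⊢
      linear_combination (2 * (a + 1 : ℝ)) * (2 * (b + 1)) * this)
    rfl (by rw [zero_odd_left, mul_zero])
    (fun c _ => zero_le_even_even (a + 1) (b + 1) c)
    (fun c hc => by have := nonneg hc (2 * a + 1) (2 * b + 1); positivity) hc0 hc
  simp only [show 2 * (a + 1) = 2 * a + 1 + 1 by ring, show 2 * (b + 1) = 2 * b + 1 + 1 by ring]
  have r1 := succ_left (c := c) (2 * a + 1 + 1 + 1) (2 * b + 1 + 1)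
  have r2 := succ_left (c := c) (2 * a + 1 + 1) (2 * b + 1)
  have r3 := succ_right (c := c) (2 * a + 1 + 1) (2 * b + 1)
  have r4 := succ_right (c := c) (2 * a + 1 + 1) (2 * b + 1 + 1 + 1)
  have r5 := succ_right (c := c) (2 * a + 1) (2 * b + 1 + 1)
  have r6 := succ_left (c := c) (2 * a + 1) (2 * b + 1 + 1)
  have r7 := succ_left (c := c) (2 * a + 1 + 1) (2 * b + 1 + 1 + 1)
  simp only [Nat.add_sub_cancel] at r1 r2 r3 r4 r5 r6 r7
  push_cast at r1 r2 r3 r4 r5 r6 r7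
  have hy : 0 < 1 - c ^ 2 := by nlinarith
  have hpos := mul_pos hy key
  simp only [reducedDet, show 2 * (a + 1) = 2 * a + 1 + 1 by ring,
    show 2 * (b + 1) = 2 * b + 1 + 1 by ring] at hpos
  set K := gaussianMixedMoment 0 (2 * a + 1 + 1) (2 * b + 1 + 1)
  set f := gaussianMixedMoment c (2 * a + 1 + 1) (2 * b + 1 + 1)
  set g := (2 * (a + 1 : ℝ)) * (2 * (b + 1)) * gaussianMixedMoment c (2 * a + 1) (2 * b + 1) with hg
  have A : gaussianMixedMoment c (2 * a + 1 + 1 + 2) (2 * b + 1 + 1) =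
      (2 * (a + 1) + 1) * f + 2 * (b + 1) * c ^ 2 * f + c * (1 - c ^ 2) * g := by
    linear_combination r1 + c * (2 * b + 2) * r2 - c ^ 2 * (2 * b + 2) * r3
  have D : gaussianMixedMoment c (2 * a + 1 + 1) (2 * b + 1 + 1 + 2) =
      (2 * (b + 1) + 1) * f + 2 * (a + 1) * c ^ 2 * f + c * (1 - c ^ 2) * g := by
    linear_combination r4 + c * (2 * a + 2) * r5 - c ^ 2 * (2 * a + 2) * r6
  have B : gaussianMixedMoment c (2 * a + 1 + 1 + 1) (2 * b + 1 + 1 + 1) =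
      (2 * (a + 1) + 2 * (b + 1) + 1) * c * f + (1 - c ^ 2) * g := by
    linear_combination r7 + (2 * a + 2 : ℝ) * r5 - c * (2 * a + 2) * r6
  rw [A, D, B]
  rw [← sub_pos]
  refine hpos.trans_eq ?_
  ring

end gaussianMixedMoment

theorem integrable_polynomial_eval_gaussianReal (g : Polynomial ℝ) (μ : ℝ) (v : NNReal) :
    Integrable (fun x => g.eval x) (gaussianReal μ v) := by
  induction g using Polynomial.induction_on' with
  | add p q hp hq =>
    simp only [Polynomial.eval_add]
    exact hp.add hq
  | monomial n a =>
    simp only [Polynomial.eval_monomial]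
    refine Integrable.const_mul ?_ a
    have h := (memLp_id_gaussianReal (μ := μ) (v := v) (n : NNReal)).integrable_norm_pow'
    exact (integrable_norm_iff (by fun_prop)).1 (by simpa using h)

/-- Stein's identity for the standard Gaussian distribution and polynomials. -/
theorem integral_id_mul_polynomial_gaussianReal (g : Polynomial ℝ) :
    ∫ x, x * g.eval x ∂gaussianReal 0 1 = ∫ x, g.derivative.eval x ∂gaussianReal 0 1 := by
  have hI : ∀ q : Polynomial ℝ, Integrable (fun x => gaussianPDFReal 0 1 x * q.eval x) := by
    intro q
    have h := integrable_polynomial_eval_gaussianReal q 0 1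
    rw [gaussianReal_of_var_ne_zero 0 one_ne_zero,
      integrable_withDensity_iff_integrable_smul' (by fun_prop)
        (by simp [gaussianPDF_lt_top])] at h
    simpa using h
  have hd : ∀ x, HasDerivAt (fun x => gaussianPDFReal 0 1 x * g.eval x)
      (gaussianPDFReal 0 1 x * (g.derivative - Polynomial.X * g).eval x) x := by
    intro x
    have h1 : HasDerivAt (gaussianPDFReal 0 1) (-x * gaussianPDFReal 0 1 x) x := by
      rw [gaussianPDFReal_def]
      have : HasDerivAt (fun x : ℝ => -(x - 0) ^ 2 / (2 * ((1 : NNReal) : ℝ))) (-x) x := by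
        refine ((((hasDerivAt_id x).sub_const 0).pow 2).neg.div_const _).congr_deriv ?_
        simp
        ring
      refine (this.exp.const_mul _).congr_deriv ?_
      ring
    refine (h1.mul (g.hasDerivAt x)).congr_deriv ?_
    simp
    ring
  have h0 := integral_eq_zero_of_hasDerivAt_of_integrable hd (hI _) (hI _)
  have h1 : ∫ x, (g.derivative - Polynomial.X * g).eval x ∂gaussianReal 0 1 = 0 := by
    rw [integral_gaussianReal_eq_integral_smul one_ne_zero]
    simpa using h0
  simp only [Polynomial.eval_sub] at h1
  rw [integral_sub (integrable_polynomial_eval_gaussianReal _ _ _)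
    (integrable_polynomial_eval_gaussianReal _ _ _), sub_eq_zero] at h1
  simpa using h1.symm

section

variable {Ω : Type*} [MeasurableSpace Ω] {P : Measure Ω} [IsProbabilityMeasure P] {Y Z : Ω → ℝ}

theorem ProbabilityTheory.HasGaussianLaw.integrable_pow (hY : HasGaussianLaw Y P) (n : ℕ) :
    Integrable (fun ω => Y ω ^ n) P := by
  have h := (hY.memLp (p := n) (by simp)).integrable_norm_pow'
  have := hY.aemeasurable
  exact (integrable_norm_iff (by fun_prop)).1 (by simpa using h)

theorem ProbabilityTheory.HasGaussianLaw.integrable_pow_mul_pow (hY : HasGaussianLaw Y P)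
    (hZ : HasGaussianLaw Z P) (j k : ℕ) : Integrable (fun ω => Y ω ^ j * Z ω ^ k) P := by
  have h1 := hY.aemeasurable
  have h2 := hZ.aemeasurable
  refine ((hY.integrable_pow (2 * j)).add (hZ.integrable_pow (2 * k))).mono' (by fun_prop)
    (.of_forall fun ω => ?_)
  rw [Real.norm_eq_abs, Pi.add_apply, mul_comm 2 j, mul_comm 2 k, pow_mul, pow_mul, abs_le]
  constructor <;> nlinarith [sq_nonneg (Y ω ^ j + Z ω ^ k), sq_nonneg (Y ω ^ j - Z ω ^ k)]

/-- Gaussian integration by parts for monomials in a Gaussian pair. -/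
theorem integral_pow_succ_mul_pow_of_hasGaussianLaw
    (h : HasGaussianLaw (fun ω => (Y ω, Z ω)) P) (hY : ∫ ω, Y ω ∂P = 0)
    (hVar : Var[Y; P] = 1) (j k : ℕ) :
    ∫ ω, Y ω ^ (j + 1) * Z ω ^ k ∂P =
      j * ∫ ω, Y ω ^ (j - 1) * Z ω ^ k ∂P +
        cov[Y, Z; P] * k * ∫ ω, Y ω ^ j * Z ω ^ (k - 1) ∂P := by
  set c := cov[Y, Z; P]
  set V : Ω → ℝ := fun ω => Z ω - c * Y ω with hV
  have hYV : HasGaussianLaw (fun ω => (Y ω, V ω)) P := by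
    have := h.map_fun ((ContinuousLinearMap.fst ℝ ℝ ℝ).prod
      (ContinuousLinearMap.snd ℝ ℝ ℝ - c • ContinuousLinearMap.fst ℝ ℝ ℝ))
    simpa [hV] using this
  have mY := h.fst.aemeasurable
  have mV := hYV.snd.aemeasurable
  have hind : IndepFun Y V P := by
    refine hYV.indepFun_of_covariance_eq_zero ?_
    rw [hV, covariance_fun_sub_right h.fst.memLp_two h.snd.memLp_two
      (h.fst.memLp_two.const_mul c), covariance_const_mul_right, covariance_self mY, hVar]
    simp [c]
  have hmap : P.map (fun ω => (Y ω, V ω)) = (gaussianReal 0 1).prod (P.map V) := by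
    rw [(indepFun_iff_map_prod_eq_prod_map_map mY mV).1 hind, h.fst.map_eq_gaussianReal, hY, hVar]
    simp
  have : IsProbabilityMeasure (P.map V) := Measure.isProbabilityMeasure_map mV
  have hint : ∀ a b : ℕ, Integrable (fun p : ℝ × ℝ => p.1 ^ a * (c * p.1 + p.2) ^ b)
      ((gaussianReal 0 1).prod (P.map V)) := by
    intro a b
    rw [← hmap, integrable_map_measure (by fun_prop) (by fun_prop)]
    simpa [Function.comp_def, hV] using h.fst.integrable_pow_mul_pow h.snd a b
  have htr : ∀ a b : ℕ, ∫ ω, Y ω ^ a * Z ω ^ b ∂P =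
      ∫ v, ∫ y, y ^ a * (c * y + v) ^ b ∂gaussianReal 0 1 ∂P.map V := by
    intro a b
    rw [← integral_prod_symm _ (hint a b), ← hmap, integral_map (by fun_prop) (by fun_prop)]
    simp [hV]
  rw [htr, htr, htr, ← integral_const_mul, ← integral_const_mul,
    ← integral_add ((hint _ _).integral_prod_right.const_mul _)
      ((hint _ _).integral_prod_right.const_mul _)]
  refine integral_congr_ae (.of_forall fun v => ?_)
  have hs := integral_id_mul_polynomial_gaussianReal
    (Polynomial.X ^ j * (Polynomial.C c * Polynomial.X + Polynomial.C v) ^ k)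
  have hi : ∀ a b : ℕ, Integrable (fun y : ℝ => y ^ a * (c * y + v) ^ b) (gaussianReal 0 1) := by
    intro a b
    have h := integrable_polynomial_eval_gaussianReal
      (Polynomial.X ^ a * (Polynomial.C c * Polynomial.X + Polynomial.C v) ^ b) 0 1
    simpa only [Polynomial.eval_mul, Polynomial.eval_pow, Polynomial.eval_add, Polynomial.eval_X,
      Polynomial.eval_C] using h
  dsimp only
  rw [← integral_const_mul, ← integral_const_mul, ← integral_add ((hi _ _).const_mul _)
    ((hi _ _).const_mul _)]
  refine Eq.trans ?_ (hs.trans ?_)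
  · refine integral_congr_ae (.of_forall fun y => ?_)
    simp
    ring
  · refine integral_congr_ae (.of_forall fun y => ?_)
    simp [Polynomial.derivative_pow]
    ring

theorem integral_pow_mul_pow_eq_gaussianMixedMoment
    (h : HasGaussianLaw (fun ω => (Y ω, Z ω)) P) (hY : ∫ ω, Y ω ∂P = 0) (hZ : ∫ ω, Z ω ∂P = 0)
    (hVarY : Var[Y; P] = 1) (hVarZ : Var[Z; P] = 1) (j k : ℕ) :
    ∫ ω, Y ω ^ j * Z ω ^ k ∂P = gaussianMixedMoment cov[Y, Z; P] j k := by
  have h' : HasGaussianLaw (fun ω => (Z ω, Y ω)) P := by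
    simpa using h.map_fun ((ContinuousLinearMap.snd ℝ ℝ ℝ).prod (ContinuousLinearMap.fst ℝ ℝ ℝ))
  induction j using Nat.strong_induction_on generalizing k with
  | _ j ih =>
    cases j with
    | zero =>
      induction k using Nat.strong_induction_on with
      | _ k ihk =>
        cases k with
        | zero => simp [gaussianMixedMoment.zero_zero]
        | succ k =>
          have := integral_pow_succ_mul_pow_of_hasGaussianLaw h' hZ hVarZ k 0
          have e := ihk (k - 1) (by omega)
          simp only [pow_zero, one_mul, mul_one, Nat.cast_zero, mul_zero, zero_mul, add_zero]
            at this e ⊢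
          rw [this, e, gaussianMixedMoment.succ_right]
          simp
    | succ j =>
      rw [integral_pow_succ_mul_pow_of_hasGaussianLaw h hY hVarY, ih (j - 1) (by omega),
        ih j (by omega), gaussianMixedMoment.succ_left]

end

section

variable {Ω : Type*} [MeasurableSpace Ω] {P : Measure Ω} [IsProbabilityMeasure P]
  {T Y Z : Ω → ℝ}

theorem covariance_sub_mul_sub_mul_left (hT : MemLp T 2 P) (hY : MemLp Y 2 P) (hZ : MemLp Z 2 P)
    {S : Ω → ℝ} (hS : MemLp S 2 P) (u v : ℝ) :
    cov[fun ω => T ω - u * Y ω - v * Z ω, S; P] =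
      cov[T, S; P] - u * cov[Y, S; P] - v * cov[Z, S; P] := by
  have hTY : MemLp (fun ω => T ω - u * Y ω) 2 P := hT.sub (hY.const_mul u)
  rw [covariance_fun_sub_left hTY (hZ.const_mul v) hS,
    covariance_fun_sub_left hT (hY.const_mul u) hS, covariance_const_mul_left,
    covariance_const_mul_left]

theorem variance_sub_covariance_mul (hY : MemLp Y 2 P) (hZ : MemLp Z 2 P)
    (hVarY : Var[Y; P] = 1) (hVarZ : Var[Z; P] = 1) :
    Var[fun ω => Z ω - cov[Y, Z; P] * Y ω; P] = 1 - cov[Y, Z; P] ^ 2 := by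
  rw [variance_fun_sub hZ (hY.const_mul _), variance_const_mul, covariance_const_mul_right,
    covariance_comm Z Y, hVarY, hVarZ]
  ring

theorem covariance_sq_le_one (hY : MemLp Y 2 P) (hZ : MemLp Z 2 P)
    (hVarY : Var[Y; P] = 1) (hVarZ : Var[Z; P] = 1) : cov[Y, Z; P] ^ 2 ≤ 1 := by
  have := variance_sub_covariance_mul hY hZ hVarY hVarZ
  have := variance_nonneg (fun ω => Z ω - cov[Y, Z; P] * Y ω) P
  linarith

theorem covariance_eq_zero_of_variance_eq_zero {S : Ω → ℝ} (hS : MemLp S 2 P)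
    (hVar : Var[S; P] = 0) : cov[T, S; P] = 0 := by
  have h := ae_eq_integral_of_variance_eq_zero hS hVar
  rw [covariance]
  refine integral_eq_zero_of_ae ?_
  filter_upwards [h] with ω hω
  simp [hω]

/-- Coefficients of the linear regression of `T` on a pair `(Y, Z)` with unit variances. -/
theorem exists_regression_coefficients (hT : MemLp T 2 P) (hY : MemLp Y 2 P) (hZ : MemLp Z 2 P)
    (hVarY : Var[Y; P] = 1) (hVarZ : Var[Z; P] = 1) :
    ∃ u v : ℝ, cov[T, Y; P] = u + v * cov[Y, Z; P] ∧ cov[T, Z; P] = u * cov[Y, Z; P] + v ∧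
      (cov[Y, Z; P] ^ 2 = 1 → v = 0) := by
  by_cases hc : cov[Y, Z; P] ^ 2 = 1
  · refine ⟨cov[T, Y; P], 0, by ring, ?_, fun _ => rfl⟩
    have h0 := variance_sub_covariance_mul hY hZ hVarY hVarZ
    rw [hc, sub_self] at h0
    have h1 := covariance_eq_zero_of_variance_eq_zero (T := T)
      (hZ.sub (hY.const_mul (cov[Y, Z; P]))) h0
    have h2 := covariance_fun_sub_right hT hZ (hY.const_mul (cov[Y, Z; P]))
    rw [covariance_const_mul_right] at h2
    have h3 : cov[T, Z; P] - cov[Y, Z; P] * cov[T, Y; P] = 0 := h2.symm.trans h1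
    linarith
  · set c := cov[Y, Z; P]
    have hc' : 1 - c ^ 2 ≠ 0 := fun h => hc (by linarith)
    refine ⟨(cov[T, Y; P] - c * cov[T, Z; P]) / (1 - c ^ 2),
      (cov[T, Z; P] - c * cov[T, Y; P]) / (1 - c ^ 2), ?_, ?_, fun h => absurd h hc⟩ <;>
    · field_simp
      ring

theorem indepFun_sub_regression (h : HasGaussianLaw (fun ω => (T ω, Y ω, Z ω)) P)
    (hVarY : Var[Y; P] = 1) (hVarZ : Var[Z; P] = 1) {u v : ℝ}
    (hTY : cov[T, Y; P] = u + v * cov[Y, Z; P]) (hTZ : cov[T, Z; P] = u * cov[Y, Z; P] + v) :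
    IndepFun (fun ω => T ω - u * Y ω - v * Z ω) (fun ω => (Y ω, Z ω)) P := by
  have hT2 := h.fst.memLp_two
  have hY2 := h.snd.fst.memLp_two
  have hZ2 := h.snd.snd.memLp_two
  have hYm := h.snd.fst.aemeasurable
  have hZm := h.snd.snd.aemeasurable
  have hG : HasGaussianLaw (fun ω => (T ω - u * Y ω - v * Z ω, (Y ω, Z ω))) P := by
    have := h.map_fun ((ContinuousLinearMap.fst ℝ ℝ (ℝ × ℝ) -
      u • (ContinuousLinearMap.fst ℝ ℝ ℝ ∘L ContinuousLinearMap.snd ℝ ℝ (ℝ × ℝ)) -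
      v • (ContinuousLinearMap.snd ℝ ℝ ℝ ∘L ContinuousLinearMap.snd ℝ ℝ (ℝ × ℝ))).prod
      (ContinuousLinearMap.snd ℝ ℝ (ℝ × ℝ)))
    simpa using this
  refine hG.indepFun_of_covariance_strongDual fun L₁ L₂ => ?_
  have e1 : L₁ ∘ (fun ω => T ω - u * Y ω - v * Z ω) =
      fun ω => L₁ 1 * (T ω - u * Y ω - v * Z ω) := by
    ext ω
    have := L₁.map_smul (T ω - u * Y ω - v * Z ω) 1
    simp only [smul_eq_mul, mul_one] at this
    simp only [Function.comp_apply, this, mul_comm]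
  have e2 : L₂ ∘ (fun ω => (Y ω, Z ω)) = fun ω => L₂ (1, 0) * Y ω + L₂ (0, 1) * Z ω := by
    ext ω
    have : (Y ω, Z ω) = Y ω • ((1 : ℝ), (0 : ℝ)) + Z ω • ((0 : ℝ), (1 : ℝ)) := by simp
    simp only [Function.comp_apply]
    rw [this, map_add, map_smul, map_smul]
    simp [mul_comm]
  rw [e1, e2, covariance_const_mul_left]
  have e3 := covariance_add_right hG.fst.memLp_two (hY2.const_mul (L₂ (1, 0)))
    (hZ2.const_mul (L₂ (0, 1)))
  rw [covariance_const_mul_right, covariance_const_mul_right,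
    covariance_sub_mul_sub_mul_left hT2 hY2 hZ2 hY2, covariance_sub_mul_sub_mul_left hT2 hY2 hZ2 hZ2,
    covariance_self hYm, covariance_self hZm, hVarY, hVarZ, hTY, hTZ, covariance_comm Z Y] at e3
  refine mul_eq_zero_of_right _ (e3.trans ?_)
  ring

theorem integral_sq_mul_pow_mul_pow_eq (h : HasGaussianLaw (fun ω => (T ω, Y ω, Z ω)) P)
    (hT : ∫ ω, T ω ∂P = 0) (hY : ∫ ω, Y ω ∂P = 0) (hZ : ∫ ω, Z ω ∂P = 0)
    (hVarY : Var[Y; P] = 1) (hVarZ : Var[Z; P] = 1) {u v : ℝ}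
    (hTY : cov[T, Y; P] = u + v * cov[Y, Z; P]) (hTZ : cov[T, Z; P] = u * cov[Y, Z; P] + v)
    (j k : ℕ) :
    ∫ ω, T ω ^ 2 * Y ω ^ j * Z ω ^ k ∂P =
      u ^ 2 * gaussianMixedMoment cov[Y, Z; P] (j + 2) k +
        2 * u * v * gaussianMixedMoment cov[Y, Z; P] (j + 1) (k + 1) +
        v ^ 2 * gaussianMixedMoment cov[Y, Z; P] j (k + 2) +
        (∫ ω, (T ω - u * Y ω - v * Z ω) ^ 2 ∂P) * gaussianMixedMoment cov[Y, Z; P] j k := by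
  have hind := indepFun_sub_regression h hVarY hVarZ hTY hTZ
  have hYg := h.snd.fst
  have hZg := h.snd.snd
  have hM := integral_pow_mul_pow_eq_gaussianMixedMoment h.snd hY hZ hVarY hVarZ
  have hI := hYg.integrable_pow_mul_pow hZg
  set W : Ω → ℝ := fun ω => T ω - u * Y ω - v * Z ω with hW
  have hWg : HasGaussianLaw W P := by
    have := h.map_fun (ContinuousLinearMap.fst ℝ ℝ (ℝ × ℝ) -
      u • (ContinuousLinearMap.fst ℝ ℝ ℝ ∘L ContinuousLinearMap.snd ℝ ℝ (ℝ × ℝ)) -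
      v • (ContinuousLinearMap.snd ℝ ℝ ℝ ∘L ContinuousLinearMap.snd ℝ ℝ (ℝ × ℝ)))
    simpa [hW] using this
  have hWm := hWg.aemeasurable
  have hYm := hYg.aemeasurable
  have hZm := hZg.aemeasurable
  have hind' : ∀ a b d : ℕ, IndepFun (fun ω => W ω ^ a) (fun ω => Y ω ^ b * Z ω ^ d) P :=
    fun a b d => hind.comp (φ := fun w : ℝ => w ^ a)
      (ψ := fun p : ℝ × ℝ => p.1 ^ b * p.2 ^ d)
      (by fun_prop) (by fun_prop)
  have hWI : ∀ a b d : ℕ, Integrable (fun ω => W ω ^ a * (Y ω ^ b * Z ω ^ d)) P :=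
    fun a b d => (hind' a b d).integrable_mul (hWg.integrable_pow a) (hI b d)
  have hWM : ∀ a b d : ℕ, ∫ ω, W ω ^ a * (Y ω ^ b * Z ω ^ d) ∂P =
      (∫ ω, W ω ^ a ∂P) * gaussianMixedMoment cov[Y, Z; P] b d := fun a b d => by
    rw [← hM]
    exact (hind' a b d).integral_fun_mul_eq_mul_integral (by fun_prop) (by fun_prop)
  have hW1 : ∫ ω, W ω ^ 1 ∂P = 0 := by
    simp only [pow_one, hW]
    have hTY : Integrable (fun ω => T ω - u * Y ω) P :=
      h.fst.integrable.sub (hYg.integrable.const_mul u)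
    rw [integral_sub hTY
      (hZg.integrable.const_mul v), integral_sub h.fst.integrable (hYg.integrable.const_mul u),
      integral_const_mul, integral_const_mul, hT, hY, hZ]
    simp
  have e : ∀ ω, T ω ^ 2 * Y ω ^ j * Z ω ^ k =
      u ^ 2 * (Y ω ^ (j + 2) * Z ω ^ k) + 2 * u * v * (Y ω ^ (j + 1) * Z ω ^ (k + 1)) +
        v ^ 2 * (Y ω ^ j * Z ω ^ (k + 2)) + 2 * u * (W ω ^ 1 * (Y ω ^ (j + 1) * Z ω ^ k)) +
        2 * v * (W ω ^ 1 * (Y ω ^ j * Z ω ^ (k + 1))) + W ω ^ 2 * (Y ω ^ j * Z ω ^ k) := by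
    intro ω
    simp only [hW]
    ring
  simp_rw [e]
  have i1 := (hI (j + 2) k).const_mul (u ^ 2)
  have i2 := (hI (j + 1) (k + 1)).const_mul (2 * u * v)
  have i3 := (hI j (k + 2)).const_mul (v ^ 2)
  have i4 := (hWI 1 (j + 1) k).const_mul (2 * u)
  have i5 := (hWI 1 j (k + 1)).const_mul (2 * v)
  rw [integral_add, integral_add, integral_add, integral_add, integral_add]
  · simp only [integral_const_mul, hM, hWM, hW1]
    ring
  exacts [i1, i2, i1.add i2, i3, (i1.add i2).add i3, i4, ((i1.add i2).add i3).add i4, i5,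
    (((i1.add i2).add i3).add i4).add i5, hWI 2 j k]

theorem integral_sq_eq_of_regression (h : HasGaussianLaw (fun ω => (T ω, Y ω, Z ω)) P)
    (hT : ∫ ω, T ω ∂P = 0) (hY : ∫ ω, Y ω ∂P = 0) (hZ : ∫ ω, Z ω ∂P = 0)
    (hVarY : Var[Y; P] = 1) (hVarZ : Var[Z; P] = 1) {u v : ℝ}
    (hTY : cov[T, Y; P] = u + v * cov[Y, Z; P]) (hTZ : cov[T, Z; P] = u * cov[Y, Z; P] + v) :
    ∫ ω, T ω ^ 2 ∂P = u ^ 2 + 2 * u * v * cov[Y, Z; P] + v ^ 2 +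
      ∫ ω, (T ω - u * Y ω - v * Z ω) ^ 2 ∂P := by
  have := integral_sq_mul_pow_mul_pow_eq h hT hY hZ hVarY hVarZ hTY hTZ 0 0
  simpa [gaussianMixedMoment] using this

/-- Gaussian product inequality with one exponent equal to `2`, for normalized second and third
components. -/
theorem gaussian_product_inequality_of_variance_eq_one
    (h : HasGaussianLaw (fun ω => (T ω, Y ω, Z ω)) P)
    (hT : ∫ ω, T ω ∂P = 0) (hY : ∫ ω, Y ω ∂P = 0) (hZ : ∫ ω, Z ω ∂P = 0)
    (hVarT : 0 < Var[T; P]) (hVarY : Var[Y; P] = 1) (hVarZ : Var[Z; P] = 1)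
    {m n : ℕ} (hm : 1 ≤ m) (hn : 1 ≤ n) :
    ((cov[T, Y; P] = 0 ∧ cov[T, Z; P] = 0 ∧ cov[Y, Z; P] = 0) →
      ∫ ω, T ω ^ 2 * Y ω ^ (2 * m) * Z ω ^ (2 * n) ∂P =
        (∫ ω, T ω ^ 2 ∂P) * (∫ ω, Y ω ^ (2 * m) ∂P) * ∫ ω, Z ω ^ (2 * n) ∂P) ∧
    (¬ (cov[T, Y; P] = 0 ∧ cov[T, Z; P] = 0 ∧ cov[Y, Z; P] = 0) →
      (∫ ω, T ω ^ 2 ∂P) * (∫ ω, Y ω ^ (2 * m) ∂P) * ∫ ω, Z ω ^ (2 * n) ∂P <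
        ∫ ω, T ω ^ 2 * Y ω ^ (2 * m) * Z ω ^ (2 * n) ∂P) := by
  have hT2 := h.fst.memLp_two
  have hY2 := h.snd.fst.memLp_two
  have hZ2 := h.snd.snd.memLp_two
  obtain ⟨u, v, hTY, hTZ, hv⟩ := exists_regression_coefficients hT2 hY2 hZ2 hVarY hVarZ
  have hM := integral_pow_mul_pow_eq_gaussianMixedMoment h.snd hY hZ hVarY hVarZ
  have hMY := hM (2 * m) 0
  have hMZ := hM 0 (2 * n)
  simp only [pow_zero, mul_one, one_mul] at hMY hMZ
  have hsq := integral_sq_eq_of_regression h hT hY hZ hVarY hVarZ hTY hTZ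
  have hvar := variance_of_integral_eq_zero h.fst.aemeasurable hT
  have hω : 0 ≤ ∫ ω, (T ω - u * Y ω - v * Z ω) ^ 2 ∂P := integral_nonneg fun _ => sq_nonneg _
  have hc1 := covariance_sq_le_one hY2 hZ2 hVarY hVarZ
  rw [mul_assoc, hMY, hMZ, ← gaussianMixedMoment.eq_mul_of_zero,
    integral_sq_mul_pow_mul_pow_eq h hT hY hZ hVarY hVarZ hTY hTZ]
  rw [hvar] at hVarT
  rw [hsq] at hVarT ⊢
  set r := ∫ ω, (T ω - u * Y ω - v * Z ω) ^ 2 ∂P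
  rw [hTY, hTZ]
  set c := cov[Y, Z; P]
  constructor
  · rintro ⟨h1, h2, hc⟩
    rw [hc, mul_zero, add_zero] at h1
    rw [h1, zero_mul, zero_add] at h2
    rw [hc, h1, h2]
    ring
  · intro hne
    have hA := gaussianMixedMoment.zero_lt_add_two hm n c
    have hF := gaussianMixedMoment.zero_le_even_even m n c
    have hF' := gaussianMixedMoment.zero_lt_even_even (c := c) hm hn
    have hdet := gaussianMixedMoment.det_pos (c := c) hm hn
    generalize gaussianMixedMoment 0 (2 * m) (2 * n) = K at *
    generalize gaussianMixedMoment c (2 * m) (2 * n) = F at *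
    generalize gaussianMixedMoment c (2 * m + 2) (2 * n) = A at *
    generalize gaussianMixedMoment c (2 * m) (2 * n + 2) = D at *
    generalize gaussianMixedMoment c (2 * m + 1) (2 * n + 1) = B at *
    rw [← sub_pos]
    suffices 0 < u ^ 2 * (A - K) + 2 * u * v * (B - c * K) + v ^ 2 * (D - K) + r * (F - K) by
      refine this.trans_eq ?_
      ring
    have hr : 0 ≤ r * (F - K) := mul_nonneg hω (sub_nonneg.2 hF)
    by_cases huv : u = 0 ∧ v = 0
    · obtain ⟨rfl, rfl⟩ := huv
      have hc : c ≠ 0 := fun hc => hne ⟨by simp, by simp, hc⟩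
      have hr' : 0 < r := by simpa using hVarT
      have := mul_pos hr' (sub_pos.2 (hF' hc))
      simpa using this
    · rcases hc1.lt_or_eq with hlt | heq
      · have hd := hdet (by rw [← sq_lt_one_iff_abs_lt_one]; exact hlt)
        suffices 0 < u ^ 2 * (A - K) + 2 * u * v * (B - c * K) + v ^ 2 * (D - K) by linarith
        refine pos_of_mul_pos_right (a := A - K) ?_ (sub_pos.2 hA).le
        have e : (A - K) * (u ^ 2 * (A - K) + 2 * u * v * (B - c * K) + v ^ 2 * (D - K)) =
            (u * (A - K) + v * (B - c * K)) ^ 2 +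
              v ^ 2 * ((A - K) * (D - K) - (B - c * K) ^ 2) := by ring
        rw [e]
        by_cases hv0 : v = 0
        · have hu : u ≠ 0 := fun hu => huv ⟨hu, hv0⟩
          have : A - K ≠ 0 := (sub_pos.2 hA).ne'
          rw [hv0]
          simp only [zero_mul, add_zero, ne_eq, OfNat.ofNat_ne_zero, not_false_eq_true, zero_pow]
          positivity
        · have := mul_pos (pow_pos (abs_pos.2 hv0) 2) (sub_pos.2 hd)
          rw [sq_abs] at this
          positivity
      · have hv0 := hv heq
        have hu : u ≠ 0 := fun hu => huv ⟨hu, hv0⟩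
        have := mul_pos (pow_pos (abs_pos.2 hu) 2) (sub_pos.2 hA)
        rw [sq_abs] at this
        rw [hv0]
        simp only [mul_zero, zero_mul, add_zero, ne_eq, OfNat.ofNat_ne_zero, not_false_eq_true,
          zero_pow]
        linarith

end

theorem theorem1p1 {Ω : Type*} [MeasurableSpace Ω] (P : Measure Ω) [IsProbabilityMeasure P]
    (m₂ m₃ : ℕ) (hm₂ : 1 ≤ m₂) (hm₃ : 1 ≤ m₃)
    (X : Fin 3 → Ω → ℝ)
    (hX : HasGaussianLaw (fun ω => fun i => X i ω) P)
    (hcentered : ∀ i, ∫ ω, X i ω ∂P = 0)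
    (hnondeg : ∀ i, 0 < variance (X i) P) :
    (∫ ω, X 0 ω ^ 2 * X 1 ω ^ (2 * m₂) * X 2 ω ^ (2 * m₃) ∂P ≥
      (∫ ω, X 0 ω ^ 2 ∂P) * (∫ ω, X 1 ω ^ (2 * m₂) ∂P) * (∫ ω, X 2 ω ^ (2 * m₃) ∂P)) ∧
    (∫ ω, X 0 ω ^ 2 * X 1 ω ^ (2 * m₂) * X 2 ω ^ (2 * m₃) ∂P =
      (∫ ω, X 0 ω ^ 2 ∂P) * (∫ ω, X 1 ω ^ (2 * m₂) ∂P) * (∫ ω, X 2 ω ^ (2 * m₃) ∂P) ↔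
        iIndepFun X P) := by
  have hs : ∀ i, 0 < √Var[X i; P] := fun i => Real.sqrt_pos.2 (hnondeg i)
  set s : Fin 3 → ℝ := fun i => √Var[X i; P] with hsdef
  set Y : Ω → ℝ := fun ω => (s 1)⁻¹ * X 1 ω with hYdef
  set Z : Ω → ℝ := fun ω => (s 2)⁻¹ * X 2 ω with hZdef
  have hG : HasGaussianLaw (fun ω => (X 0 ω, Y ω, Z ω)) P := by
    have := hX.map_fun ((ContinuousLinearMap.proj (R := ℝ) (φ := fun _ : Fin 3 => ℝ) 0).prod
      (((s 1)⁻¹ • ContinuousLinearMap.proj (R := ℝ) (φ := fun _ : Fin 3 => ℝ) 1).prod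
        ((s 2)⁻¹ • ContinuousLinearMap.proj (R := ℝ) (φ := fun _ : Fin 3 => ℝ) 2)))
    simpa [hYdef, hZdef] using this
  have hVar : ∀ i, (s i)⁻¹ ^ 2 * Var[X i; P] = 1 := fun i => by
    rw [hsdef, inv_pow, Real.sq_sqrt (hnondeg i).le, inv_mul_cancel₀ (hnondeg i).ne']
  have key := gaussian_product_inequality_of_variance_eq_one hG (hcentered 0)
    (by rw [hYdef, integral_const_mul, hcentered, mul_zero])
    (by rw [hZdef, integral_const_mul, hcentered, mul_zero]) (hnondeg 0)
    (by rw [hYdef, variance_const_mul, hVar]) (by rw [hZdef, variance_const_mul, hVar]) hm₂ hm₃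
  have h1 := (inv_pos.2 (hs 1)).ne'
  have h2 := (inv_pos.2 (hs 2)).ne'
  have hcov : (cov[X 0, Y; P] = 0 ∧ cov[X 0, Z; P] = 0 ∧ cov[Y, Z; P] = 0) ↔ iIndepFun X P := by
    rw [hYdef, hZdef, covariance_const_mul_right, covariance_const_mul_right,
      covariance_const_mul_left, covariance_const_mul_right]
    simp only [mul_eq_zero, hsdef, h1, h2, false_or]
    constructor
    · rintro ⟨h01, h02, h12⟩
      refine hX.iIndepFun_of_covariance_eq_zero fun i j hij => ?_
      fin_cases i <;> fin_cases j <;> simp at hij ⊢ <;>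
        first | assumption | (rw [covariance_comm]; assumption)
    · intro hI
      have h : ∀ i j, i ≠ j → cov[X i, X j; P] = 0 := fun i j hij =>
        (hI.indepFun hij).covariance_eq_zero (hX.eval i).memLp_two (hX.eval j).memLp_two
      exact ⟨h 0 1 (by decide), h 0 2 (by decide), h 1 2 (by decide)⟩
  rw [hcov] at key
  have e1 : ∫ ω, X 0 ω ^ 2 * Y ω ^ (2 * m₂) * Z ω ^ (2 * m₃) ∂P =
      ((s 1)⁻¹ ^ (2 * m₂) * (s 2)⁻¹ ^ (2 * m₃)) *
        ∫ ω, X 0 ω ^ 2 * X 1 ω ^ (2 * m₂) * X 2 ω ^ (2 * m₃) ∂P := by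
    rw [← integral_const_mul]
    refine integral_congr_ae (.of_forall fun ω => ?_)
    simp only [hYdef, hZdef, mul_pow]
    ring
  have e2 : (∫ ω, X 0 ω ^ 2 ∂P) * (∫ ω, Y ω ^ (2 * m₂) ∂P) * (∫ ω, Z ω ^ (2 * m₃) ∂P) =
      ((s 1)⁻¹ ^ (2 * m₂) * (s 2)⁻¹ ^ (2 * m₃)) *
        ((∫ ω, X 0 ω ^ 2 ∂P) * (∫ ω, X 1 ω ^ (2 * m₂) ∂P) * (∫ ω, X 2 ω ^ (2 * m₃) ∂P)) := by
    simp only [hYdef, hZdef, mul_pow, integral_const_mul]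
    ring
  have hpos : 0 < (s 1)⁻¹ ^ (2 * m₂) * (s 2)⁻¹ ^ (2 * m₃) :=
    mul_pos (pow_pos (inv_pos.2 (hs 1)) _) (pow_pos (inv_pos.2 (hs 2)) _)
  rw [e1, e2, mul_right_inj' hpos.ne', mul_lt_mul_iff_right₀ hpos] at key
  by_cases hI : iIndepFun X P
  · exact ⟨(key.1 hI).ge, iff_of_true (key.1 hI) hI⟩
  · exact ⟨(key.2 hI).le, iff_of_false (key.2 hI).ne' hI⟩
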